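/- \textbf{Theorem (Oracle inequality).} Let $K:\mathbb R\to\mathbb R$ be a bounded, square-integrable kernel with $\int K=1$, and put $K_h(x)=\tfrac1h K(x/h)$ and $\|K\|_\infty=\sup_x|K(x)|$. Let $X_1,\dots,X_n$ be i.i.d. real random variables with Lebesgue density $f$, let $t\in\mathbb R$, let $\alpha\in(0,1)$, and let $\mathcal H\subset(0,1)$ be a non-empty finite collection of bandwidths with $|\mathcal H|\le n$ and $nh\ge\max(\log n,1)$ for all $h\in\mathcal H$. For $h\in\mathcal H$ the $i$-th data holder releases, with privacy parameter $\alpha/|\mathcal H|$, $$Z_{i,h}=K_h(X_i-t)+\frac{2\|K\|_\infty}{(\alpha/|\mathcal H|)\,h}\,\xi_{i,h},$$ where the $\xi_{i,h}$ are i.i.d. $\mathrm{Laplace}(0,1)$ (density $\tfrac12e^{-|x|}$) and independent of $(X_i)_i$. Put $$\hat f_h(t)=\frac1n\sum_{i=1}^n Z_{i,h},\qquad f_h(t)=\mathbb E\hat f_h(t),\qquad \hat\sigma_h^2=\frac1n\sum_{i=1}^n Z_{i,h}^2,\qquad \sigma_h^2=\mathbb E Z_{i,h}^2,$$ and, with $c_1=600$,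 $c_2=432$ and $\{x\}_+=\max(x,0)$, $$\hat V(h)=\Big(2c_1\frac{\hat\sigma_h^2}{n}+c_2\frac1{nh}\Big)\log n,\qquad \hat A(h)=\max_{\eta\in\mathcal H,\ \eta\le h}\big\{|\hat f_h(t)-\hat f_\eta(t)|^2-(\hat V(h)+\hat V(\eta))\big\}_+ ,$$ $$V(h)=\Big(c_1\frac{\sigma_h^2}{n}+c_2\frac1{nh}\Big)\log n,\qquad \mathrm{bias}^2(h)=\max_{\eta\in\mathcal H,\ \eta\le h}|f_\eta(t)-f(t)|^2 .$$ Let $\hat h$ be a (measurable) random bandwidth with $\hat h\in\operatorname{argmin}_{h\in\mathcal H}\{\hat A(h)+\hat V(h)\}$. Then $$\mathbb E\,|\hat f_{\hat h}(t)-f(t)|^2\ \le\ 16\min_{h\in\mathcal H}\{\mathrm{bias}^2(h)+V(h)\}+\frac{C}{n\alpha^2},$$ where $C$ is a constant depending only on $\|K\|_\infty$. -/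

import Mathlib

open MeasureTheory ProbabilityTheory

noncomputable section

namespace PrivateKDE

/-- The supremum norm `‖K‖_∞` (a genuine supremum whenever `K` is bounded). -/
def supNorm (K : ℝ → ℝ) : ℝ := ⨆ x : ℝ, |K x|

/-- A kernel function: measurable, bounded, square-integrable, with integral `1`. -/
structure IsKernel (K : ℝ → ℝ) : Prop where
  measurable : Measurable K
  bounded : BddAbove (Set.range fun x : ℝ => |K x|)
  memLp_two : MemLp K 2 volume
  integrable : Integrable K volume
  integral_eq_one : ∫ x, K x = 1

/-- A probability density on the real line, with respect to Lebesgue measure. -/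
structure IsDensity (f : ℝ → ℝ) : Prop where
  measurable : Measurable f
  nonneg : ∀ x, 0 ≤ f x
  integrable : Integrable f volume
  integral_eq_one : ∫ x, f x = 1

/-- The law on `ℝ` with Lebesgue density `f`. -/
def densityLaw (f : ℝ → ℝ) : Measure ℝ :=
  volume.withDensity fun x => ENNReal.ofReal (f x)

/-- The `Laplace(0,1)` distribution, with density `x ↦ exp(-|x|)/2`. -/
def laplaceLaw : Measure ℝ := densityLaw fun x => (1 / 2) * Real.exp (-|x|)

/-- The rescaled kernel `K_h(x) = K(x/h)/h`. -/
def scaledKernel (K : ℝ → ℝ) (h x : ℝ) : ℝ := (1 / h) * K (x / h)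

variable {Ω : Type*} [MeasurableSpace Ω]

/-- The raw observations `X i` are i.i.d. with density `f`, the noise variables `ξ i h`, for
`i` a data holder and `h` a bandwidth of the collection `H`, are i.i.d. `Laplace(0,1)`, and all of
these variables together are mutually independent. -/
structure IsSample (P : Measure Ω) (f : ℝ → ℝ) (H : Finset ℝ) {n : ℕ}
    (X : Fin n → Ω → ℝ) (ξ : Fin n → ℝ → Ω → ℝ) : Prop where
  measurable_obs : ∀ i, Measurable (X i)
  measurable_noise : ∀ i, ∀ h ∈ H, Measurable (ξ i h)
  law_obs : ∀ i, P.map (X i) = densityLaw f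
  law_noise : ∀ i, ∀ h ∈ H, P.map (ξ i h) = laplaceLaw
  indep : iIndepFun
    (fun j : Fin n ⊕ (Fin n × {h : ℝ // h ∈ H}) =>
      Sum.elim X (fun p : Fin n × {h : ℝ // h ∈ H} => ξ p.1 p.2.1) j) P

section Procedure

variable (K : ℝ → ℝ) (H : Finset ℝ) (α t : ℝ) {n : ℕ}
  (X : Fin n → Ω → ℝ) (ξ : Fin n → ℝ → Ω → ℝ)

/-- The value `Z_{i,h}` released by data holder `i` for bandwidth `h`: the Laplace perturbation of
`K_h(X_i - t)` at privacy parameter `α / |H|`. -/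
def release (i : Fin n) (h : ℝ) (ω : Ω) : ℝ :=
  scaledKernel K h (X i ω - t) + 2 * supNorm K / ((α / (H.card : ℝ)) * h) * ξ i h ω

/-- The private kernel estimator `n⁻¹ ∑ᵢ Z_{i,h}` of `f(t)`. -/
def estimator (h : ℝ) (ω : Ω) : ℝ :=
  (1 / (n : ℝ)) * ∑ i : Fin n, release K H α t X ξ i h ω

/-- The empirical second moment `n⁻¹ ∑ᵢ Z_{i,h}²`. -/
def empSecondMoment (h : ℝ) (ω : Ω) : ℝ :=
  (1 / (n : ℝ)) * ∑ i : Fin n, release K H α t X ξ i h ω ^ 2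

/-- The random variance term `V̂(h)`, with `c₁ = 600` and `c₂ = 432`. -/
def empV (h : ℝ) (ω : Ω) : ℝ :=
  (2 * 600 * (empSecondMoment K H α t X ξ h ω / (n : ℝ)) + 432 * (1 / ((n : ℝ) * h)))
    * Real.log (n : ℝ)

/-- The comparison term `Â(h)`: the maximum over `η ∈ H`, `η ≤ h`, of the positive part of
`|f̂_h(t) - f̂_η(t)|² - (V̂(h) + V̂(η))`. -/
def empA (h : ℝ) (ω : Ω) : ℝ :=
  ⨆ η : {η : ℝ // η ∈ H ∧ η ≤ h},
    max (|estimator K H α t X ξ h ω - estimator K H α t X ξ η.1 ω| ^ 2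
      - (empV K H α t X ξ h ω + empV K H α t X ξ η.1 ω)) 0

/-- `hhat` is a (measurable) bandwidth selector which minimises `Â + V̂` over `H`. -/
structure IsSelector (hhat : Ω → ℝ) : Prop where
  measurable : Measurable hhat
  mem : ∀ ω, hhat ω ∈ H
  minimises : ∀ ω, ∀ h ∈ H,
    empA K H α t X ξ (hhat ω) ω + empV K H α t X ξ (hhat ω) ω
      ≤ empA K H α t X ξ h ω + empV K H α t X ξ h ω

/-- `f_h(t) = E[f̂_h(t)]`. -/
def meanEstimator (P : Measure Ω) (h : ℝ) : ℝ := ∫ ω, estimator K H α t X ξ h ω ∂P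

/-- `bias²(h)`, the maximum of `|f_η(t) - f(t)|²` over `η ∈ H`, `η ≤ h`. -/
def biasSq (P : Measure Ω) (f : ℝ → ℝ) (h : ℝ) : ℝ :=
  ⨆ η : {η : ℝ // η ∈ H ∧ η ≤ h}, |meanEstimator K H α t X ξ P η.1 - f t| ^ 2

/-- `σ_h² = E[Z_{i,h}²]` (the same for all `i` when the observations are identically
distributed). -/
def secondMoment (P : Measure Ω) (i : Fin n) (h : ℝ) : ℝ :=
  ∫ ω, release K H α t X ξ i h ω ^ 2 ∂P

/-- The variance term `V(h)`, with `c₁ = 600` and `c₂ = 432`. -/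
def V (P : Measure Ω) (i : Fin n) (h : ℝ) : ℝ :=
  (600 * (secondMoment K H α t X ξ P i h / (n : ℝ)) + 432 * (1 / ((n : ℝ) * h)))
    * Real.log (n : ℝ)

end Procedure

end PrivateKDE

end

/-! Dividing a released value by its noise scale `b = 2‖K‖∞|H|/(αh)` leaves a variable bounded by
1/2 plus an independent standard Laplace variable. All concentration is therefore proved once, free
of scale, for sums of such variables.

The key estimate is `IsPerturbedSample.integral_excess_le`. Let `S` be the centred sum and `Q` the
sum of squares. Then `18 S² - 1200 (log n) Q` has expected positive part `O(n⁻⁴)`. Either `Q <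
3n/2`, which is exponentially unlikely because each square has mean at least 2, or `Q` dominates
`S²` unless `S² > 100 n log n`, which a Chernoff bound makes rare. The empirical variance term thus
pays for the stochastic error without any knowledge of `σ_h²`. Since `b ≤ 2‖K‖∞n²/α`, scaling by
`(b/n)²` gives `O(n⁻²α⁻²)` per bandwidth, and summing over at most `n` bandwidths gives the
remainder `C/(nα²)`.

The rest is the Goldenshluger-Lepski argument. Any two estimators differ, in square, by at most the
sum of their criteria `Â + V̂`, so minimality compares the selected bandwidth with any fixed `h`
(`IsSelector.sq_estimator_sub_le`). `empA_le` bounds `Â(h)` by the bias and the excesses. Taking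
expectations with `E V̂ ≤ 2V` and the bias-variance bound at `h` concludes. -/

noncomputable section

namespace PrivateKDE

/-! ### Moments and exponential moments of the Laplace law. -/

/-- Integration against the Laplace law. -/
lemma integral_laplaceLaw (g : ℝ → ℝ) :
    ∫ x, g x ∂laplaceLaw = ∫ x, (1 / 2) * Real.exp (-|x|) * g x := by
  rw [laplaceLaw, densityLaw, integral_withDensity_eq_integral_toReal_smul]
  · refine integral_congr_ae (Filter.Eventually.of_forall fun x => ?_)
    simp only [smul_eq_mul]
    rw [ENNReal.toReal_ofReal (by positivity)]
  · fun_prop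
  · exact Filter.Eventually.of_forall fun x => ENNReal.ofReal_lt_top

lemma integrable_laplaceLaw_iff (g : ℝ → ℝ) :
    Integrable g laplaceLaw ↔ Integrable (fun x => (1 / 2) * Real.exp (-|x|) * g x) volume := by
  rw [laplaceLaw, densityLaw, integrable_withDensity_iff_integrable_smul']
  · refine integrable_congr (Filter.Eventually.of_forall fun x => ?_)
    simp only [smul_eq_mul]
    rw [ENNReal.toReal_ofReal (by positivity)]
  · fun_prop
  · exact Filter.Eventually.of_forall fun x => ENNReal.ofReal_lt_top

lemma laplace_exp_integrand_Ioi (s : ℝ) :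
    Set.EqOn (fun x : ℝ => (1 / 2) * Real.exp (-|x|) * Real.exp (s * x))
      (fun x => (1 / 2) * Real.exp ((s - 1) * x)) (Set.Ioi 0) := by
  intro x hx
  simp only
  rw [abs_of_pos hx, mul_assoc, ← Real.exp_add]
  ring_nf

lemma laplace_exp_integrand_Iic (s : ℝ) :
    Set.EqOn (fun x : ℝ => (1 / 2) * Real.exp (-|x|) * Real.exp (s * x))
      (fun x => (1 / 2) * Real.exp ((s + 1) * x)) (Set.Iic 0) := by
  intro x hx
  simp only
  rw [abs_of_nonpos hx, mul_assoc, ← Real.exp_add]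
  ring_nf

lemma integrableOn_laplace_exp {s : ℝ} (h1 : -1 < s) (h2 : s < 1) :
    IntegrableOn (fun x : ℝ => (1 / 2) * Real.exp (-|x|) * Real.exp (s * x)) (Set.Iic 0) ∧
    IntegrableOn (fun x : ℝ => (1 / 2) * Real.exp (-|x|) * Real.exp (s * x)) (Set.Ioi 0) := by
  constructor
  · rw [integrableOn_congr_fun (laplace_exp_integrand_Iic s) measurableSet_Iic]
    exact (integrableOn_exp_mul_Iic (by linarith) 0).const_mul _
  · rw [integrableOn_congr_fun (laplace_exp_integrand_Ioi s) measurableSet_Ioi]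
    exact (integrableOn_exp_mul_Ioi (by linarith) 0).const_mul _

/-- The exponential moments of the Laplace law are finite on `(-1, 1)`. -/
lemma integrable_exp_mul_laplaceLaw {s : ℝ} (h1 : -1 < s) (h2 : s < 1) :
    Integrable (fun x => Real.exp (s * x)) laplaceLaw := by
  rw [integrable_laplaceLaw_iff, ← integrableOn_univ, ← Set.Iic_union_Ioi (a := (0 : ℝ)),
    integrableOn_union]
  exact integrableOn_laplace_exp h1 h2

/-- The moment generating function of the Laplace law. -/
lemma integral_exp_mul_laplaceLaw {s : ℝ} (h1 : -1 < s) (h2 : s < 1) :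
    ∫ x, Real.exp (s * x) ∂laplaceLaw = 1 / (1 - s ^ 2) := by
  obtain ⟨i1, i2⟩ := integrableOn_laplace_exp h1 h2
  rw [integral_laplaceLaw, ← intervalIntegral.integral_Iic_add_Ioi i1 i2,
    setIntegral_congr_fun measurableSet_Iic (laplace_exp_integrand_Iic s),
    setIntegral_congr_fun measurableSet_Ioi (laplace_exp_integrand_Ioi s),
    integral_const_mul, integral_const_mul, integral_exp_mul_Iic (by linarith),
    integral_exp_mul_Ioi (by linarith)]
  have e1 : s + 1 ≠ 0 := by linarith
  have e2 : s - 1 ≠ 0 := by linarith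
  have e3 : 1 - s ^ 2 ≠ 0 := by nlinarith
  simp only [mul_zero, Real.exp_zero]
  field_simp
  ring

lemma integrable_pow_laplaceLaw (k : ℕ) : Integrable (fun x : ℝ => x ^ k) laplaceLaw := by
  refine integrable_pow_of_mem_interior_integrableExpSet (X := fun x : ℝ => x) ?_ k
  refine mem_interior.2 ⟨Set.Ioo (-1) 1, fun s hs => ?_, isOpen_Ioo, by norm_num⟩
  exact integrable_exp_mul_laplaceLaw hs.1 hs.2

lemma integral_id_laplaceLaw : ∫ x, x ∂laplaceLaw = 0 := by
  rw [integral_laplaceLaw]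
  have h := integral_neg_eq_self (fun x : ℝ => (1 / 2) * Real.exp (-|x|) * x) volume
  simp only [abs_neg, mul_neg, integral_neg] at h
  linarith

/-- The even moments of the Laplace law. -/
lemma integral_even_pow_laplaceLaw {k : ℕ} (hk : Even k) :
    ∫ x, x ^ k ∂laplaceLaw = (k.factorial : ℝ) := by
  rw [integral_laplaceLaw]
  have h := integral_comp_abs (f := fun x : ℝ => (1 / 2) * Real.exp (-x) * x ^ k)
  simp only [hk.pow_abs] at h
  rw [h, ← Real.Gamma_nat_eq_factorial, Real.Gamma_eq_integral (by positivity)]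
  simp only [add_sub_cancel_right, Real.rpow_natCast, mul_assoc, integral_const_mul]
  ring

/-! ### Grouping independent families, and elementary inequalities. -/

/-- A family of independent families: grouping an independent double family by its first index
gives an independent family. -/
lemma iIndepFun_curry {Ω : Type*} [MeasurableSpace Ω] {P : Measure Ω} {ι κ : Type*}
    {Y : ι → κ → Ω → ℝ} (mY : ∀ i j, Measurable (Y i j))
    (h : iIndepFun (fun p : (_ : ι) × κ => Y p.1 p.2) P) :
    iIndepFun (fun i ω j => Y i j ω) P := by
  have := h.isProbabilityMeasure
  have hp : ∀ i j, IsProbabilityMeasure (P.map (Y i j)) :=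
    fun i j ↦ Measure.isProbabilityMeasure_map (mY i j).aemeasurable
  have e := (iIndepFun_iff_map_fun_eq_infinitePi_map (by fun_prop)).1 h
  rw [iIndepFun_iff_map_fun_eq_infinitePi_map (by fun_prop)]
  have h2 : ∀ i, P.map (fun ω j => Y i j ω) = Measure.infinitePi fun j => P.map (Y i j) := fun i =>
    (iIndepFun_iff_map_fun_eq_infinitePi_map (by fun_prop)).1
      (h.precomp (g := fun j : κ => (⟨i, j⟩ : (_ : ι) × κ)) (fun a b hab => by simpa using hab))
  simp_rw [h2]
  rw [← Measure.infinitePi_map_piCurry (fun i j ↦ P.map (Y i j)), ← e,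
    Measure.map_map (by fun_prop) (by fun_prop)]
  rfl

/-- Follows from `1 + y + y²/2 ≤ exp y`, because `(1 - y + y²/2)(1 + y + y²/2) = 1 + y⁴/4 ≥ 1`. -/
lemma exp_neg_le_quadratic {y : ℝ} (hy : 0 ≤ y) : Real.exp (-y) ≤ 1 - y + y ^ 2 / 2 := by
  have h := Real.quadratic_le_exp_of_nonneg hy
  have hp : 0 < 1 - y + y ^ 2 / 2 := by nlinarith [sq_nonneg (y - 1)]
  rw [Real.exp_neg, inv_le_comm₀ (Real.exp_pos y) hp]
  refine le_trans ?_ h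
  rw [inv_le_iff_one_le_mul₀ hp]
  nlinarith [sq_nonneg (y ^ 2)]

lemma sq_le_exp_quarter {y : ℝ} (hy : 0 ≤ y) : y ^ 2 ≤ 32 * Real.exp (y / 4) := by
  have h := Real.quadratic_le_exp_of_nonneg (x := y / 4) (by positivity)
  nlinarith

lemma exp_mul_abs_le (c x : ℝ) :
    Real.exp (c * |x|) ≤ Real.exp (c * x) + Real.exp (-c * x) := by
  rcases abs_cases x with ⟨h, -⟩ | ⟨h, -⟩ <;> rw [h]
  · linarith [Real.exp_pos (-c * x)]
  · rw [mul_neg, ← neg_mul]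
    linarith [Real.exp_pos (c * x)]

/-- Deterministic comparison of a self-normalised deviation with exponential functionals. -/
lemma deviation_le_exp {N L s S T Q m : ℝ} (hN : 0 < N) (hL : 0 < L) (hs : 0 < s)
    (hsL : s ^ 2 * N = L) (hS : S = T - m) (hm : |m| ≤ N / 2) (hT : T ^ 2 ≤ N * Q) :
    max (18 * S ^ 2 - 1200 * L * Q) 0 ≤
      18 * (32 / s ^ 2) * Real.exp (-(10 * L)) *
          (Real.exp (5 / 4 * s * S) + Real.exp (-(5 / 4 * s) * S))
        + 72 * N ^ 2 * Real.exp (1 / 400 * (3 / 2 * N - Q)) := by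
  have hQ : 0 ≤ Q := by
    by_contra h
    nlinarith [sq_nonneg T, mul_neg_of_pos_of_neg hN (not_le.1 h)]
  have p1 : 0 ≤ 18 * (32 / s ^ 2) * Real.exp (-(10 * L)) *
          (Real.exp (5 / 4 * s * S) + Real.exp (-(5 / 4 * s) * S)) := by positivity
  have p2 : 0 ≤ 72 * N ^ 2 * Real.exp (1 / 400 * (3 / 2 * N - Q)) := by positivity
  refine max_le ?_ (by positivity)
  -- For small `Q`, Cauchy-Schwarz (`hT`) gives the crude bound `S² ≤ 4N²`, and the last exponential
  -- is at least 1.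
  rcases lt_or_ge Q (3 / 2 * N) with h | h
  · have hm2 : m ^ 2 ≤ (N / 2) ^ 2 := sq_le_sq' (by linarith [abs_le.1 hm]) (abs_le.1 hm).2
    have hNQ : N * Q ≤ N * (3 / 2 * N) := by gcongr
    have hS2 : S ^ 2 ≤ 4 * N ^ 2 := by
      rw [hS]
      nlinarith [sq_nonneg (T + m)]
    have he : 1 ≤ Real.exp (1 / 400 * (3 / 2 * N - Q)) := Real.one_le_exp (by linarith)
    have : 72 * N ^ 2 * 1 ≤ 72 * N ^ 2 * Real.exp (1 / 400 * (3 / 2 * N - Q)) := by gcongr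
    have : 0 ≤ L * Q := by positivity
    linarith
  -- The threshold 100 is chosen so that `18 * 100 = 1200 * (3/2)`: below it there is no excess.
  · rcases le_or_gt (S ^ 2) (100 * N * L) with h2 | h2
    · have : L * (3 / 2 * N) ≤ L * Q := by gcongr
      nlinarith
    · have hy : 10 * L ≤ s * |S| := by
        refine le_of_sq_le_sq ?_ (by positivity)
        rw [mul_pow, mul_pow, sq_abs]
        have : s ^ 2 * (100 * N * L) ≤ s ^ 2 * S ^ 2 := by gcongr
        have e : s ^ 2 * (100 * N * L) = 100 * L ^ 2 := by rw [← hsL]; ring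
        linarith
      have h3 := sq_le_exp_quarter (y := s * |S|) (by positivity)
      -- Chernoff's device: `s|S| ≥ 10L` allows a whole factor `exp(s|S| - 10L) ≥ 1` to be inserted.
      have h4 : Real.exp (s * |S| / 4) ≤ Real.exp (-(10 * L)) * Real.exp (5 / 4 * s * |S|) := by
        rw [← Real.exp_add]
        exact Real.exp_le_exp.2 (by linarith)
      have h5 := exp_mul_abs_le (5 / 4 * s) S
      have h6 : S ^ 2 ≤ 32 / s ^ 2 * Real.exp (-(10 * L)) *
          (Real.exp (5 / 4 * s * S) + Real.exp (-(5 / 4 * s) * S)) := by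
        rw [div_mul_eq_mul_div, div_mul_eq_mul_div, le_div_iff₀ (by positivity)]
        calc S ^ 2 * s ^ 2 = (s * |S|) ^ 2 := by rw [mul_pow, sq_abs]; ring
          _ ≤ 32 * Real.exp (s * |S| / 4) := h3
          _ ≤ 32 * (Real.exp (-(10 * L)) *
              (Real.exp (5 / 4 * s * S) + Real.exp (-(5 / 4 * s) * S))) := by
            gcongr
            exact h4.trans (by gcongr)
          _ = _ := by ring
      have : 0 ≤ L * Q := by positivity
      linarith

/-! ### One bounded-plus-Laplace variable. -/

section Single

variable {Ω : Type*} [MeasurableSpace Ω] {P : Measure Ω} [IsProbabilityMeasure P]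

variable {κ ξ : Ω → ℝ} (hκ : Measurable κ) (hb : ∀ ω, |κ ω| ≤ 1 / 2) (hξ : Measurable ξ)
  (hlaw : P.map ξ = laplaceLaw) (hind : IndepFun κ ξ P)

omit [IsProbabilityMeasure P] in
include hξ hlaw in
lemma integral_comp_laplace {g : ℝ → ℝ} (hg : Measurable g) :
    ∫ ω, g (ξ ω) ∂P = ∫ x, g x ∂laplaceLaw := by
  rw [← hlaw, integral_map hξ.aemeasurable hg.aestronglyMeasurable]

omit [IsProbabilityMeasure P] in
include hξ hlaw in
lemma integrable_comp_laplace {g : ℝ → ℝ} (hg : Measurable g) (hi : Integrable g laplaceLaw) :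
    Integrable (fun ω => g (ξ ω)) P := by
  rw [← hlaw] at hi
  exact (integrable_map_measure hg.aestronglyMeasurable hξ.aemeasurable).1 hi

include hκ hb in
lemma integrable_of_abs_le_half : Integrable κ P :=
  Integrable.of_bound hκ.aestronglyMeasurable (1 / 2) (Filter.Eventually.of_forall hb)

include hκ hb hξ hlaw hind in
/-- Sub-Gaussian control, near the origin, of the centred bounded-plus-Laplace variable. -/
lemma exp_moment_perturbed_le {r : ℝ} (hr : r ^ 2 ≤ 0.5788) :
    Integrable (fun ω => Real.exp (r * (κ ω + ξ ω - ∫ ω, κ ω ∂P))) P ∧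
      ∫ ω, Real.exp (r * (κ ω + ξ ω - ∫ ω, κ ω ∂P)) ∂P ≤ Real.exp (5 / 2 * r ^ 2) := by
  have hr1 : -1 < r := by nlinarith
  have hr2 : r < 1 := by nlinarith
  have hsub := hasSubgaussianMGF_of_mem_Icc (μ := P) (X := κ) (a := -(1 / 2)) (b := 1 / 2)
    hκ.aemeasurable (Filter.Eventually.of_forall fun ω => abs_le.1 (hb ω))
  have hmeas : Measurable fun x : ℝ => Real.exp (r * x) := by fun_prop
  have i1 := integrable_comp_laplace (P := P) hξ hlaw hmeas (integrable_exp_mul_laplaceLaw hr1 hr2)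
  have i2 := hsub.integrable_exp_mul r
  have hind' : IndepFun (fun ω => κ ω - ∫ ω, κ ω ∂P) ξ P :=
    hind.comp (φ := fun x => x - ∫ ω, κ ω ∂P) (ψ := id) (by fun_prop) measurable_id
  have hfun : (fun ω => κ ω + ξ ω - ∫ ω, κ ω ∂P) = (fun ω => κ ω - ∫ ω, κ ω ∂P) + ξ := by
    ext ω; simp; ring
  have hint := hind'.integrable_exp_mul_add i2 i1
  have hmgf := hind'.mgf_add' (t := r) (by fun_prop) (by fun_prop)
  rw [← hfun] at hint hmgf
  refine ⟨by simpa [← hfun] using! hint, ?_⟩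
  change mgf (fun ω => κ ω + ξ ω - ∫ ω, κ ω ∂P) P r ≤ _
  rw [hmgf]
  have b1 := hsub.mgf_le r
  have b2 : mgf ξ P r ≤ Real.exp (19 / 8 * r ^ 2) := by
    have : mgf ξ P r = 1 / (1 - r ^ 2) := by
      rw [← integral_exp_mul_laplaceLaw hr1 hr2, ← integral_comp_laplace hξ hlaw hmeas]
      rfl
    rw [this]
    have hpos : 0 < 1 - r ^ 2 := by nlinarith
    -- `1/(1 - r²) ≤ 1 + (19/8)r²` holds exactly when `r² ≤ 11/19`, whence the bound 0.5788. With
    -- Hoeffding's 1/8 for the bounded part, the total is 5/2.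
    refine le_trans ?_ (Real.add_one_le_exp _)
    rw [div_le_iff₀ hpos]
    nlinarith [sq_nonneg r]
  have b1' : mgf (fun ω => κ ω - ∫ ω, κ ω ∂P) P r ≤ Real.exp (1 / 8 * r ^ 2) := by
    refine b1.trans (Real.exp_le_exp.2 (le_of_eq ?_))
    norm_num
    ring
  calc _ ≤ Real.exp (1 / 8 * r ^ 2) * Real.exp (19 / 8 * r ^ 2) := by
        gcongr
        exact mgf_nonneg
    _ = _ := by rw [← Real.exp_add]; ring_nf

include hκ hb hξ hlaw hind in
-- The cross term vanishes by independence and centring of the noise, so the Laplace variance 2 is a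
-- lower bound. This keeps the empirical second moment away from zero.
lemma perturbed_sq_moment :
    Integrable (fun ω => (κ ω + ξ ω) ^ 2) P ∧ 2 ≤ ∫ ω, (κ ω + ξ ω) ^ 2 ∂P := by
  have iκ := integrable_of_abs_le_half (P := P) hκ hb
  have iξ : Integrable ξ P := integrable_comp_laplace (g := fun x => x) hξ hlaw measurable_id
    (by simpa using integrable_pow_laplaceLaw 1)
  have iξ2 : Integrable (fun ω => ξ ω ^ 2) P := integrable_comp_laplace (g := fun x => x ^ 2)
    hξ hlaw (by fun_prop) (integrable_pow_laplaceLaw 2)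
  have iκξ : Integrable (fun ω => κ ω * ξ ω) P := hind.integrable_mul iκ iξ
  have iκ2 : Integrable (fun ω => κ ω ^ 2) P := by
    refine Integrable.of_bound (by fun_prop) (1 / 4) (Filter.Eventually.of_forall fun ω => ?_)
    rw [Real.norm_eq_abs, abs_pow]
    nlinarith [hb ω, abs_nonneg (κ ω)]
  have e : (fun ω => (κ ω + ξ ω) ^ 2) = fun ω => (κ ω ^ 2 + 2 * (κ ω * ξ ω)) + ξ ω ^ 2 := by
    ext ω; ring
  have hκξ : ∫ ω, κ ω * ξ ω ∂P = 0 := by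
    rw [hind.integral_fun_mul_eq_mul_integral (by fun_prop) (by fun_prop),
      integral_comp_laplace (g := fun x => x) hξ hlaw measurable_id, integral_id_laplaceLaw, mul_zero]
  have hξ2 : ∫ ω, ξ ω ^ 2 ∂P = 2 := by
    rw [integral_comp_laplace (g := fun x => x ^ 2) hξ hlaw (by fun_prop),
      integral_even_pow_laplaceLaw (by decide)]
    norm_num [Nat.factorial]
  have i3 : Integrable (fun ω => κ ω ^ 2 + 2 * (κ ω * ξ ω)) P := iκ2.add (iκξ.const_mul 2)
  rw [e]
  refine ⟨i3.add iξ2, ?_⟩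
  rw [integral_add i3 iξ2, integral_add iκ2 (iκξ.const_mul 2), integral_const_mul, hκξ, hξ2]
  have : 0 ≤ ∫ ω, κ ω ^ 2 ∂P := integral_nonneg fun ω => sq_nonneg _
  linarith

include hκ hb hξ hlaw in
lemma perturbed_fourth_moment :
    Integrable (fun ω => (κ ω + ξ ω) ^ 4) P ∧ ∫ ω, (κ ω + ξ ω) ^ 4 ∂P ≤ 193 := by
  have iξ4 : Integrable (fun ω => ξ ω ^ 4) P := integrable_comp_laplace (g := fun x => x ^ 4)
    hξ hlaw (by fun_prop) (integrable_pow_laplaceLaw 4)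
  have hξ4 : ∫ ω, ξ ω ^ 4 ∂P = 24 := by
    rw [integral_comp_laplace (g := fun x => x ^ 4) hξ hlaw (by fun_prop),
      integral_even_pow_laplaceLaw (by decide)]
    norm_num [Nat.factorial]
  -- From `(x + y)⁴ ≤ 8(x⁴ + y⁴)`. As the Laplace fourth moment is 24, the bound is `1 + 8 * 24 =
  -- 193`.
  have bd : ∀ ω, (κ ω + ξ ω) ^ 4 ≤ 1 + 8 * ξ ω ^ 4 := by
    intro ω
    have h1 : κ ω ^ 2 ≤ 1 / 4 := by
      rw [← sq_abs]
      nlinarith [hb ω, abs_nonneg (κ ω)]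
    have h2 : (κ ω + ξ ω) ^ 2 ≤ 2 * (κ ω ^ 2 + ξ ω ^ 2) := by nlinarith [sq_nonneg (κ ω - ξ ω)]
    have h3 : ((κ ω + ξ ω) ^ 2) ^ 2 ≤ (2 * (κ ω ^ 2 + ξ ω ^ 2)) ^ 2 :=
      pow_le_pow_left₀ (sq_nonneg _) h2 2
    nlinarith [sq_nonneg (κ ω ^ 2 - ξ ω ^ 2), sq_nonneg (κ ω)]
  have i : Integrable (fun ω => 1 + 8 * ξ ω ^ 4) P := (integrable_const 1).add (iξ4.const_mul 8)
  have i2 : Integrable (fun ω => (κ ω + ξ ω) ^ 4) P := by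
    refine i.mono' (by fun_prop) (Filter.Eventually.of_forall fun ω => ?_)
    rw [Real.norm_eq_abs, abs_of_nonneg (by positivity)]
    exact bd ω
  refine ⟨i2, (integral_mono i2 i bd).trans ?_⟩
  rw [integral_add (integrable_const 1) (iξ4.const_mul 8), integral_const_mul, hξ4]
  norm_num

include hκ hb hξ hlaw hind in
-- A nonnegative variable has a light lower tail as soon as its second moment is finite: expand
-- `exp(-y)` to second order at `y = (κ + ξ)²/400`.
lemma integral_exp_neg_perturbed_sq_le :
    ∫ ω, Real.exp (-(1 / 400 * (κ ω + ξ ω) ^ 2)) ∂P ≤ Real.exp (-(703 / 160000)) := by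
  obtain ⟨i2, h2⟩ := perturbed_sq_moment (P := P) hκ hb hξ hlaw hind
  obtain ⟨i4, h4⟩ := perturbed_fourth_moment (P := P) hκ hb hξ hlaw
  have i' : Integrable (fun ω => 1 - 1 / 400 * (κ ω + ξ ω) ^ 2) P :=
    (integrable_const 1).sub (i2.const_mul _)
  have i : Integrable (fun ω => 1 - 1 / 400 * (κ ω + ξ ω) ^ 2
      + 1 / 320000 * (κ ω + ξ ω) ^ 4) P := i'.add (i4.const_mul _)
  have hle : ∫ ω, Real.exp (-(1 / 400 * (κ ω + ξ ω) ^ 2)) ∂P ≤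
      ∫ ω, (1 - 1 / 400 * (κ ω + ξ ω) ^ 2 + 1 / 320000 * (κ ω + ξ ω) ^ 4) ∂P := by
    refine integral_mono_of_nonneg (Filter.Eventually.of_forall fun ω => (Real.exp_pos _).le) i
      (Filter.Eventually.of_forall fun ω => ?_)
    refine (exp_neg_le_quadratic (by positivity)).trans (le_of_eq ?_)
    ring
  rw [integral_add i' (i4.const_mul _),
    integral_sub (integrable_const 1) (i2.const_mul _), integral_const_mul, integral_const_mul] at hle
  refine hle.trans (le_trans ?_ (Real.add_one_le_exp _))
  simp only [integral_const, probReal_univ, smul_eq_mul]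
  -- `-2/400 + 193/320000 = -1407/320000`, just below `-703/160000`.
  linarith

end Single

/-! ### Concentration for sums of bounded-plus-Laplace variables. -/

section PerturbedSample

variable {Ω : Type*} [MeasurableSpace Ω] {P : Measure Ω}

/-- Independent pairs (bounded variable, Laplace variable), one for each index. -/
structure IsPerturbedSample (P : Measure Ω) {n : ℕ} (κ ξ : Fin n → Ω → ℝ) : Prop where
  measurable_bounded : ∀ i, Measurable (κ i)
  abs_le : ∀ i ω, |κ i ω| ≤ 1 / 2
  measurable_noise : ∀ i, Measurable (ξ i)
  law_noise : ∀ i, P.map (ξ i) = laplaceLaw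
  indep : iIndepFun (fun p : (_ : Fin n) × Bool => cond p.2 (κ p.1) (ξ p.1)) P

namespace IsPerturbedSample

variable {n : ℕ} {κ ξ : Fin n → Ω → ℝ} (h : IsPerturbedSample P κ ξ)

include h

lemma indepFun (i : Fin n) : IndepFun (κ i) (ξ i) P :=
  h.indep.indepFun (i := ⟨i, true⟩) (j := ⟨i, false⟩) (by simp)

lemma iIndepFun_comp {g : Fin n → ℝ → ℝ → ℝ} (hg : ∀ i, Measurable (Function.uncurry (g i))) :
    iIndepFun (fun i ω => g i (κ i ω) (ξ i ω)) P := by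
  have hc := iIndepFun_curry (Y := fun (i : Fin n) (b : Bool) => cond b (κ i) (ξ i)) (P := P)
    (fun i b => by cases b; exacts [h.measurable_noise i, h.measurable_bounded i]) h.indep
  exact hc.comp (fun i y => g i (y true) (y false)) fun i =>
    (hg i).comp (f := fun y : Bool → ℝ => (y true, y false)) (by fun_prop)

lemma exp_moment_sum_le {r : ℝ} (hr : r ^ 2 ≤ 0.5788) :
    Integrable (fun ω => Real.exp
      (r * (∑ i, (κ i ω + ξ i ω) - ∑ i, ∫ ω, κ i ω ∂P))) P ∧
    ∫ ω, Real.exp (r * (∑ i, (κ i ω + ξ i ω) - ∑ i, ∫ ω, κ i ω ∂P)) ∂P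
      ≤ Real.exp (5 / 2 * r ^ 2 * n) := by
  have := h.indep.isProbabilityMeasure
  have hone := fun i => exp_moment_perturbed_le (h.measurable_bounded i) (h.abs_le i)
    (h.measurable_noise i) (h.law_noise i) (h.indepFun i) hr
  have hind := h.iIndepFun_comp (g := fun i x y => x + y - ∫ ω, κ i ω ∂P) (fun i => by
    unfold Function.uncurry; fun_prop)
  have hm : ∀ i, Measurable fun ω => κ i ω + ξ i ω - ∫ ω, κ i ω ∂P := fun i =>
    ((h.measurable_bounded i).add (h.measurable_noise i)).sub_const _
  have hfun : (fun ω => ∑ i, (κ i ω + ξ i ω) - ∑ i, ∫ ω, κ i ω ∂P) =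
      ∑ i, fun ω => κ i ω + ξ i ω - ∫ ω, κ i ω ∂P := by
    ext ω; simp [Finset.sum_sub_distrib]
  have hint := hind.integrable_exp_mul_sum (t := r) hm (s := Finset.univ) fun i _ => (hone i).1
  have hmgf := hind.mgf_sum (t := r) hm Finset.univ
  rw [← hfun] at hint hmgf
  refine ⟨hint, ?_⟩
  change mgf (fun ω => ∑ i, (κ i ω + ξ i ω) - ∑ i, ∫ ω, κ i ω ∂P) P r ≤ _
  rw [hmgf]
  calc _ ≤ ∏ _i : Fin n, Real.exp (5 / 2 * r ^ 2) :=
        Finset.prod_le_prod (fun i _ => mgf_nonneg) fun i _ => (hone i).2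
    _ = _ := by
        rw [Finset.prod_const, Finset.card_univ, Fintype.card_fin, ← Real.exp_nat_mul, mul_comm]

/-- Each square has mean at least 2, so a sum below `3n/2` is a large deviation. The tilt 1/400 is
small enough for the second-order term to leave a negative exponent: `3/800 - 703/160000 < -1/2000`.
-/
lemma exp_moment_sum_sq_le :
    Integrable (fun ω => Real.exp (1 / 400 * (3 / 2 * n - ∑ i, (κ i ω + ξ i ω) ^ 2))) P ∧
    ∫ ω, Real.exp (1 / 400 * (3 / 2 * n - ∑ i, (κ i ω + ξ i ω) ^ 2)) ∂P
      ≤ Real.exp (-(n / 2000)) := by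
  have := h.indep.isProbabilityMeasure
  have hone := fun i => integral_exp_neg_perturbed_sq_le (h.measurable_bounded i) (h.abs_le i)
    (h.measurable_noise i) (h.law_noise i) (h.indepFun i)
  have hind := h.iIndepFun_comp (g := fun i x y => Real.exp (-(1 / 400 * (x + y) ^ 2))) (fun i => by
    unfold Function.uncurry; fun_prop)
  have hm : ∀ i, Measurable fun ω => Real.exp (-(1 / 400 * (κ i ω + ξ i ω) ^ 2)) := fun i => by
    have := h.measurable_bounded i
    have := h.measurable_noise i
    fun_prop
  have hprod := hind.integral_fun_prod_eq_prod_integral fun i => (hm i).aestronglyMeasurable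
  have hfun : (fun ω => Real.exp (1 / 400 * (3 / 2 * n - ∑ i, (κ i ω + ξ i ω) ^ 2))) =
      fun ω => Real.exp (3 / 800 * n) * ∏ i, Real.exp (-(1 / 400 * (κ i ω + ξ i ω) ^ 2)) := by
    ext ω
    rw [← Real.exp_sum, ← Real.exp_add, Finset.sum_neg_distrib, ← Finset.mul_sum]
    congr 1; ring
  have hle : ∀ ω, Real.exp (1 / 400 * (3 / 2 * n - ∑ i, (κ i ω + ξ i ω) ^ 2))
      ≤ Real.exp (3 / 800 * n) := fun ω => Real.exp_le_exp.2 (by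
    have : 0 ≤ ∑ i, (κ i ω + ξ i ω) ^ 2 := Finset.sum_nonneg fun i _ => sq_nonneg _
    linarith)
  constructor
  · refine Integrable.of_bound ?_ (Real.exp (3 / 800 * n)) (Filter.Eventually.of_forall fun ω => ?_)
    · rw [hfun]
      exact ((Finset.measurable_prod _ fun i _ => hm i).const_mul _).aestronglyMeasurable
    · rw [Real.norm_eq_abs, Real.abs_exp]
      exact hle ω
  · rw [hfun, integral_const_mul, hprod]
    calc _ ≤ Real.exp (3 / 800 * n) * ∏ _i : Fin n, Real.exp (-(703 / 160000)) := by
          gcongr with i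
          exact hone i
      _ = Real.exp (3 / 800 * n + n * -(703 / 160000)) := by
          rw [Finset.prod_const, Finset.card_univ, Fintype.card_fin, ← Real.exp_nat_mul,
            ← Real.exp_add]
      _ ≤ _ := Real.exp_le_exp.2 (by
          have : (0 : ℝ) ≤ n := n.cast_nonneg
          linarith)

end IsPerturbedSample

/-- A universal constant for the expected excess of the self-normalised deviation. -/
def excessConst : ℝ := 2304 + 72 * (720 * 2000 ^ 6)

/-- The sharp bound is `log x ≤ x/e`. The value 0.37 is close enough to `1/e` that `(25/16) * 0.37`
stays below 0.5788, the range of the exponential moment bound. -/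
lemma log_le_mul_of_pos {x : ℝ} (hx : 0 < x) : Real.log x ≤ 0.37 * x := by
  have h := Real.exp_one_mul_le_exp (x := Real.log x)
  rw [Real.exp_log hx] at h
  have he := Real.exp_one_gt_d9
  rcases le_or_gt (Real.log x) 0 with h0 | h0
  · linarith
  · nlinarith

/-- Integrates `deviation_le_exp` with `s = √(log n / n)`. The power `n⁻⁴` absorbs the growth `n⁴`
of the squared noise scale. -/
lemma IsPerturbedSample.integral_excess_le {n : ℕ} {κ ξ : Fin n → Ω → ℝ}
    (h : IsPerturbedSample P κ ξ) (hn : 2 ≤ n) :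
    ∫ ω, max (18 * (∑ i, (κ i ω + ξ i ω) - ∑ i, ∫ ω, κ i ω ∂P) ^ 2
        - 1200 * Real.log n * ∑ i, (κ i ω + ξ i ω) ^ 2) 0 ∂P ≤ excessConst / (n : ℝ) ^ 4 := by
  have := h.indep.isProbabilityMeasure
  have hn2 : (2 : ℝ) ≤ n := by exact_mod_cast hn
  have hn0 : (0 : ℝ) < n := by linarith
  have hL : 1 / 2 < Real.log n := by
    have := Real.log_le_log (by norm_num) hn2
    linarith [Real.log_two_gt_d9]
  set L := Real.log n with hLdef
  set s := Real.sqrt (L / n) with hsdef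
  have hs : 0 < s := Real.sqrt_pos.2 (by positivity)
  have hs2 : s ^ 2 = L / n := Real.sq_sqrt (by positivity)
  have hsL : s ^ 2 * n = L := by rw [hs2]; field_simp
  have hr : (5 / 4 * s) ^ 2 ≤ 0.5788 := by
    have : s ^ 2 ≤ 0.37 := by
      rw [hs2, div_le_iff₀ hn0]
      exact log_le_mul_of_pos hn0
    rw [mul_pow]
    linarith
  obtain ⟨i1, h1⟩ := h.exp_moment_sum_le hr
  obtain ⟨i2, h2⟩ := h.exp_moment_sum_le (r := -(5 / 4 * s)) (by rwa [neg_sq])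
  obtain ⟨i3, h3⟩ := h.exp_moment_sum_sq_le
  rw [neg_sq] at h2
  have hm : |∑ i, ∫ ω, κ i ω ∂P| ≤ (n : ℝ) / 2 := by
    refine (Finset.abs_sum_le_sum_abs _ _).trans ?_
    calc _ ≤ ∑ _i : Fin n, (1 / 2 : ℝ) := by
          refine Finset.sum_le_sum fun i _ => ?_
          have := norm_integral_le_of_norm_le_const (μ := P) (f := κ i) (C := 1 / 2)
            (Filter.Eventually.of_forall (h.abs_le i))
          simpa using this
      _ = _ := by simp; ring
  have hT : ∀ ω, (∑ i, (κ i ω + ξ i ω)) ^ 2 ≤ n * ∑ i, (κ i ω + ξ i ω) ^ 2 := fun ω => by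
    simpa using sq_sum_le_card_mul_sum_sq (s := Finset.univ) (f := fun i : Fin n => κ i ω + ξ i ω)
  have hpt := fun ω => deviation_le_exp (N := n) (L := L) hn0 (by linarith) hs hsL
    (S := ∑ i, (κ i ω + ξ i ω) - ∑ i, ∫ ω, κ i ω ∂P) rfl hm (hT ω)
  have i12 : Integrable (fun ω => 18 * (32 / s ^ 2) * Real.exp (-(10 * L)) *
          (Real.exp (5 / 4 * s * (∑ i, (κ i ω + ξ i ω) - ∑ i, ∫ ω, κ i ω ∂P))
            + Real.exp (-(5 / 4 * s) * (∑ i, (κ i ω + ξ i ω) - ∑ i, ∫ ω, κ i ω ∂P)))) P :=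
    (i1.add i2).const_mul _
  have i3' : Integrable (fun ω => 72 * (n : ℝ) ^ 2 *
      Real.exp (1 / 400 * (3 / 2 * n - ∑ i, (κ i ω + ξ i ω) ^ 2))) P := i3.const_mul _
  refine (integral_mono_of_nonneg (Filter.Eventually.of_forall fun ω => le_max_right _ _)
    (i12.add i3') (Filter.Eventually.of_forall hpt)).trans ?_
  rw [integral_add' i12 i3', integral_const_mul, integral_const_mul, integral_add i1 i2]
  have hexpL : Real.exp L = n := Real.exp_log hn0
  have a1 : 18 * (32 / s ^ 2) * Real.exp (-(10 * L)) *
      (Real.exp (5 / 2 * (5 / 4 * s) ^ 2 * n) + Real.exp (5 / 2 * (5 / 4 * s) ^ 2 * n))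
        ≤ 2304 / (n : ℝ) ^ 4 := by
    have e1 : 5 / 2 * (5 / 4 * s) ^ 2 * n = 125 / 32 * L := by rw [← hsL]; ring
    have e2 : 1 / s ^ 2 ≤ 2 * n := by
      rw [hs2, one_div_div, div_le_iff₀ (by linarith)]
      nlinarith
    -- `10 - 125/32 > 5`; one of the five powers of `n` is then lost to `1/s² ≤ 2n`.
    have e3 : Real.exp (-(10 * L)) * Real.exp (125 / 32 * L) ≤ 1 / (n : ℝ) ^ 5 := by
      rw [← hexpL, ← Real.exp_add, ← Real.exp_nat_mul, one_div, ← Real.exp_neg]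
      refine Real.exp_le_exp.2 ?_
      push_cast
      linarith
    rw [e1]
    calc _ = 1152 * (1 / s ^ 2) * (Real.exp (-(10 * L)) * Real.exp (125 / 32 * L)) := by ring
      _ ≤ 1152 * (2 * n) * (1 / (n : ℝ) ^ 5) := by gcongr
      _ = _ := by field_simp; norm_num
  have a2 : 72 * (n : ℝ) ^ 2 * Real.exp (-(n / 2000)) ≤ 72 * (720 * 2000 ^ 6) / (n : ℝ) ^ 4 := by
    -- The sixth power offsets the prefactor `n²` and leaves `n⁻⁴`.
    have := Real.pow_div_factorial_le_exp (x := (n : ℝ) / 2000) (by positivity) 6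
    rw [div_le_iff₀ (by positivity), div_pow, div_le_iff₀ (by positivity)] at this
    rw [Real.exp_neg, le_div_iff₀ (by positivity)]
    have hpos := Real.exp_pos ((n : ℝ) / 2000)
    rw [show 72 * (n : ℝ) ^ 2 * (Real.exp (n / 2000))⁻¹ * n ^ 4 =
      72 * n ^ 6 / Real.exp (n / 2000) by field_simp, div_le_iff₀ hpos]
    have : ((Nat.factorial 6 : ℕ) : ℝ) = 720 := by norm_num [Nat.factorial]
    nlinarith
  calc _ ≤ 18 * (32 / s ^ 2) * Real.exp (-(10 * L)) *
      (Real.exp (5 / 2 * (5 / 4 * s) ^ 2 * n) + Real.exp (5 / 2 * (5 / 4 * s) ^ 2 * n))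
        + 72 * (n : ℝ) ^ 2 * Real.exp (-(n / 2000)) := by gcongr
    _ ≤ 2304 / (n : ℝ) ^ 4 + 72 * (720 * 2000 ^ 6) / (n : ℝ) ^ 4 := add_le_add a1 a2
    _ = _ := by rw [excessConst, add_div]

end PerturbedSample

/-! ### The noise scale and its bounds. -/

section Kernel

variable {K : ℝ → ℝ} (hK : IsKernel K)

include hK

lemma IsKernel.abs_le_supNorm (x : ℝ) : |K x| ≤ supNorm K := le_ciSup hK.bounded x

lemma IsKernel.supNorm_pos : 0 < supNorm K := by
  by_contra h
  have h0 : ∀ x, K x = 0 := fun x =>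
    abs_nonpos_iff.1 ((hK.abs_le_supNorm x).trans (not_lt.1 h))
  have := hK.integral_eq_one
  simp [h0] at this

end Kernel

/-- The scale of the Laplace noise added at bandwidth `h`. -/
def noiseScale (K : ℝ → ℝ) (H : Finset ℝ) (α h : ℝ) : ℝ :=
  2 * supNorm K / ((α / (H.card : ℝ)) * h)

section Scale

variable {K : ℝ → ℝ} {H : Finset ℝ} {α h : ℝ}

lemma noiseScale_pos (hK : IsKernel K) (hα : 0 < α) (hh : h ∈ H) (h0 : 0 < h) :
    0 < noiseScale K H α h := by
  have := hK.supNorm_pos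
  have : 0 < H.card := Finset.card_pos.2 ⟨h, hh⟩
  unfold noiseScale
  positivity

/-- Since `α/|H| ≤ 1`, the noise scale is at least `2‖K‖∞/h`, twice the supremum of the rescaled
kernel. -/
lemma abs_scaledKernel_le (hK : IsKernel K) (hα : 0 < α) (hα1 : α < 1) (hh : h ∈ H) (h0 : 0 < h)
    (x : ℝ) : |scaledKernel K h x| ≤ 1 / 2 * noiseScale K H α h := by
  have hM := hK.supNorm_pos
  have hc : (1 : ℝ) ≤ H.card := by exact_mod_cast Finset.card_pos.2 ⟨h, hh⟩
  rw [scaledKernel, noiseScale, abs_mul, abs_of_pos (by positivity : 0 < 1 / h)]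
  calc 1 / h * |K (x / h)| ≤ 1 / h * supNorm K := by
        gcongr
        exact hK.abs_le_supNorm _
    _ = 1 / 2 * (2 * supNorm K / (1 * h)) := by ring
    _ ≤ _ := by
        gcongr
        rw [div_le_one (by linarith)]
        linarith

lemma noiseScale_le (hK : IsKernel K) (hα : 0 < α) {n : ℕ} (hn : H.card ≤ n) (h0 : 0 < h)
    (hnh : 1 ≤ n * h) : noiseScale K H α h ≤ 2 * supNorm K * (n : ℝ) ^ 2 / α := by
  have hM := hK.supNorm_pos
  have hc : (H.card : ℝ) ≤ n := by exact_mod_cast hn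
  have hi : 1 / h ≤ n := by rwa [div_le_iff₀ h0]
  calc noiseScale K H α h = 2 * supNorm K * (H.card * (1 / h)) / α := by
        rw [noiseScale]; field_simp
    _ ≤ 2 * supNorm K * (n * n) / α := by gcongr
    _ = _ := by ring

end Scale

/-! ### Reduction of the released data to the normalised model; moments of the estimator. -/

section Sample

variable {Ω : Type*} [MeasurableSpace Ω] {P : Measure Ω} {K f : ℝ → ℝ} {H : Finset ℝ}
  {α t : ℝ} {n : ℕ} {X : Fin n → Ω → ℝ} {ξ : Fin n → ℝ → Ω → ℝ} {h : ℝ}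

/-- The kernel part of the released value, in units of the noise scale. -/
def normalizedKernel (K : ℝ → ℝ) (H : Finset ℝ) (α t : ℝ) (X : Fin n → Ω → ℝ) (h : ℝ)
    (i : Fin n) (ω : Ω) : ℝ :=
  scaledKernel K h (X i ω - t) / noiseScale K H α h

omit [MeasurableSpace Ω] in
lemma release_eq (hK : IsKernel K) (hα : 0 < α) (hh : h ∈ H) (h0 : 0 < h) (i : Fin n) (ω : Ω) :
    release K H α t X ξ i h ω =
      noiseScale K H α h * (normalizedKernel K H α t X h i ω + ξ i h ω) := by
  have := (noiseScale_pos hK hα hh h0).ne'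
  rw [release, normalizedKernel, mul_add, mul_div_cancel₀ _ this]
  rfl

omit [MeasurableSpace Ω] in
lemma empSecondMoment_eq (hK : IsKernel K) (hα : 0 < α) (hh : h ∈ H) (h0 : 0 < h) (ω : Ω) :
    empSecondMoment K H α t X ξ h ω = noiseScale K H α h ^ 2 / n *
      ∑ i, (normalizedKernel K H α t X h i ω + ξ i h ω) ^ 2 := by
  rw [empSecondMoment]
  simp_rw [release_eq (t := t) (X := X) (ξ := ξ) hK hα hh h0, mul_pow]
  rw [← Finset.mul_sum]
  ring

lemma IsSample.isPerturbedSample (hS : IsSample P f H X ξ) (hK : IsKernel K) (hα : 0 < α)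
    (hα1 : α < 1) (hh : h ∈ H) (h0 : 0 < h) :
    IsPerturbedSample P (normalizedKernel K H α t X h) (fun i => ξ i h) := by
  have hs := noiseScale_pos hK hα hh h0
  have hmK : Measurable fun x => scaledKernel K h (x - t) / noiseScale K H α h := by
    have := hK.measurable
    unfold scaledKernel
    fun_prop
  refine ⟨fun i => hmK.comp (hS.measurable_obs i), fun i ω => ?_,
    fun i => hS.measurable_noise i h hh, fun i => hS.law_noise i h hh, ?_⟩
  · rw [normalizedKernel, abs_div, abs_of_pos hs, div_le_iff₀ hs]
    exact abs_scaledKernel_le hK hα hα1 hh h0 _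
  -- Only the observations and the noise at this one `h` matter; `e` selects them from the full
  -- independent family.
  · let e : ((_ : Fin n) × Bool) → Fin n ⊕ (Fin n × {h : ℝ // h ∈ H}) :=
      fun p => cond p.2 (Sum.inl p.1) (Sum.inr (p.1, ⟨h, hh⟩))
    have he : Function.Injective e := by
      rintro ⟨i, _ | _⟩ ⟨j, _ | _⟩ hij <;> simp_all [e]
    have hc := (hS.indep.precomp he).comp
      (fun p => cond p.2 (fun x => scaledKernel K h (x - t) / noiseScale K H α h) id) (by
        rintro ⟨i, _ | _⟩
        exacts [measurable_id, hmK])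
    convert hc using 2 with p
    obtain ⟨i, _ | _⟩ := p <;> rfl

section Estimator

variable (hS : IsSample P f H X ξ) (hK : IsKernel K) (hα : 0 < α)
    (hα1 : α < 1) (hh : h ∈ H) (h0 : 0 < h)

include hS hK hα hα1 hh h0

lemma measurable_release (i : Fin n) : Measurable (release K H α t X ξ i h) := by
  have hp := hS.isPerturbedSample (t := t) hK hα hα1 hh h0
  simp_rw [funext (release_eq (t := t) (X := X) (ξ := ξ) hK hα hh h0 i)]
  exact ((hp.measurable_bounded i).add (hp.measurable_noise i)).const_mul _

lemma memLp_release (i : Fin n) : MemLp (release K H α t X ξ i h) 2 P := by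
  have hp := hS.isPerturbedSample (t := t) hK hα hα1 hh h0
  have := hp.indep.isProbabilityMeasure
  rw [memLp_two_iff_integrable_sq (measurable_release hS hK hα hα1 hh h0 i).aestronglyMeasurable]
  simp_rw [release_eq (t := t) (X := X) (ξ := ξ) hK hα hh h0 i, mul_pow]
  exact (perturbed_sq_moment (hp.measurable_bounded i) (hp.abs_le i) (hp.measurable_noise i)
    (hp.law_noise i) (hp.indepFun i)).1.const_mul _

lemma integrable_release (i : Fin n) : Integrable (release K H α t X ξ i h) P := by
  have := hS.indep.isProbabilityMeasure
  exact (memLp_release hS hK hα hα1 hh h0 i).integrable (by norm_num)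

lemma memLp_estimator : MemLp (estimator K H α t X ξ h) 2 P :=
  (memLp_finsetSum Finset.univ fun i _ => memLp_release hS hK hα hα1 hh h0 i).const_mul _

lemma meanEstimator_eq :
    meanEstimator K H α t X ξ P h = (1 / (n : ℝ)) *
      (noiseScale K H α h * ∑ i, ∫ ω, normalizedKernel K H α t X h i ω ∂P) := by
  have hp := hS.isPerturbedSample (t := t) hK hα hα1 hh h0
  have := hp.indep.isProbabilityMeasure
  unfold meanEstimator estimator
  rw [integral_const_mul, integral_finsetSum _ fun i _ => integrable_release hS hK hα hα1 hh h0 i,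
    Finset.mul_sum (Finset.univ : Finset (Fin n)) _ (noiseScale K H α h)]
  congr 1
  refine Finset.sum_congr rfl fun i _ => ?_
  simp_rw [release_eq (t := t) (X := X) (ξ := ξ) hK hα hh h0 i]
  rw [integral_const_mul, integral_add
    (integrable_of_abs_le_half (hp.measurable_bounded i) (hp.abs_le i))
    (integrable_comp_laplace (g := fun x => x) (hp.measurable_noise i) (hp.law_noise i)
      measurable_id (by simpa using integrable_pow_laplaceLaw 1)),
    integral_comp_laplace (g := fun x => x) (hp.measurable_noise i) (hp.law_noise i) measurable_id,
    integral_id_laplaceLaw, add_zero]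

lemma estimator_sub_mean (ω : Ω) :
    estimator K H α t X ξ h ω - meanEstimator K H α t X ξ P h = noiseScale K H α h / n *
      (∑ i, (normalizedKernel K H α t X h i ω + ξ i h ω)
        - ∑ i, ∫ ω, normalizedKernel K H α t X h i ω ∂P) := by
  rw [meanEstimator_eq hS hK hα hα1 hh h0, estimator]
  simp_rw [release_eq (t := t) (X := X) (ξ := ξ) hK hα hh h0]
  rw [← Finset.mul_sum]
  ring

lemma integrable_empSecondMoment : Integrable (empSecondMoment K H α t X ξ h) P :=
  (integrable_finsetSum Finset.univ fun i _ =>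
    (memLp_release hS hK hα hα1 hh h0 i).integrable_sq).const_mul _

lemma integrable_empV : Integrable (empV K H α t X ξ h) P := by
  have := hS.indep.isProbabilityMeasure
  exact (((((integrable_empSecondMoment hS hK hα hα1 hh h0).div_const _).const_mul _).add
    (integrable_const _)).mul_const _)

lemma integrable_sq_estimator_sub (c : ℝ) :
    Integrable (fun ω => (estimator K H α t X ξ h ω - c) ^ 2) P := by
  have := hS.indep.isProbabilityMeasure
  exact ((memLp_estimator hS hK hα hα1 hh h0).sub (memLp_const c)).integrable_sq

/-- The expected excess of the stochastic error over the empirical variance term. -/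
lemma integral_excess_le (hn2 : 2 ≤ n) (hcard : H.card ≤ n) (hnh : 1 ≤ n * h) :
    ∫ ω, max (18 * (estimator K H α t X ξ h ω - meanEstimator K H α t X ξ P h) ^ 2
        - empV K H α t X ξ h ω) 0 ∂P ≤
      4 * supNorm K ^ 2 * excessConst / ((n : ℝ) ^ 2 * α ^ 2) := by
  have hp := hS.isPerturbedSample (t := t) hK hα hα1 hh h0
  have := hp.indep.isProbabilityMeasure
  have hs := noiseScale_pos hK hα hh h0
  have hn0 : (0 : ℝ) < n := by
    have : (2 : ℝ) ≤ n := by exact_mod_cast hn2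
    linarith
  have hlog : 0 ≤ Real.log n := Real.log_natCast_nonneg n
  set b := noiseScale K H α h
  set m := ∑ i, ∫ ω, normalizedKernel K H α t X h i ω ∂P
  have hle : ∀ ω, max (18 * (estimator K H α t X ξ h ω - meanEstimator K H α t X ξ P h) ^ 2
        - empV K H α t X ξ h ω) 0 ≤ (b / n) ^ 2 *
      max (18 * (∑ i, (normalizedKernel K H α t X h i ω + ξ i h ω) - m) ^ 2 -
        1200 * Real.log n * ∑ i, (normalizedKernel K H α t X h i ω + ξ i h ω) ^ 2) 0 := by
    intro ω
    rw [mul_max_of_nonneg _ _ (by positivity), mul_zero]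
    refine max_le_max ?_ le_rfl
    rw [estimator_sub_mean hS hK hα hα1 hh h0, empV, empSecondMoment_eq hK hα hh h0]
    -- The deterministic part of `V̂` is not needed: the random part alone dominates.
    have : 0 ≤ 432 * (1 / ((n : ℝ) * h)) * Real.log n := by positivity
    have e : 2 * 600 * ((b ^ 2 / n * ∑ i, (normalizedKernel K H α t X h i ω + ξ i h ω) ^ 2) / n)
        * Real.log n = (b / n) ^ 2 * (1200 * Real.log n *
          ∑ i, (normalizedKernel K H α t X h i ω + ξ i h ω) ^ 2) := by ring
    rw [add_mul, e]
    linarith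
  have iS : Integrable (fun ω =>
      (∑ i, (normalizedKernel K H α t X h i ω + ξ i h ω) - m) ^ 2) P := by
    have hi := (integrable_sq_estimator_sub (t := t) hS hK hα hα1 hh h0
      (meanEstimator K H α t X ξ P h)).const_mul ((n / b) ^ 2)
    refine hi.congr (Filter.Eventually.of_forall fun ω => ?_)
    simp only
    rw [estimator_sub_mean hS hK hα hα1 hh h0, ← mul_pow, ← mul_assoc,
      div_mul_div_cancel₀ hs.ne', div_self hn0.ne', one_mul]
  have iQ : Integrable (fun ω =>
      ∑ i, (normalizedKernel K H α t X h i ω + ξ i h ω) ^ 2) P :=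
    integrable_finsetSum _ fun i _ =>
      (perturbed_sq_moment (hp.measurable_bounded i) (hp.abs_le i) (hp.measurable_noise i)
        (hp.law_noise i) (hp.indepFun i)).1
  have iD : Integrable (fun ω => (b / n) ^ 2 *
      max (18 * (∑ i, (normalizedKernel K H α t X h i ω + ξ i h ω) - m) ^ 2 -
        1200 * Real.log n * ∑ i, (normalizedKernel K H α t X h i ω + ξ i h ω) ^ 2) 0) P :=
    ((iS.const_mul 18).sub (iQ.const_mul _)).pos_part.const_mul _
  refine (integral_mono_of_nonneg (Filter.Eventually.of_forall fun ω => le_max_right _ _) iD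
    (Filter.Eventually.of_forall hle)).trans ?_
  rw [integral_const_mul]
  have hb := noiseScale_le hK hα hcard h0 hnh
  have hC : 0 ≤ excessConst := by unfold excessConst; positivity
  -- `(b/n)² = O(n²/α²)` against `n⁻⁴` leaves `n⁻²`, one power of which pays for the sum over
  -- bandwidths.
  calc _ ≤ (2 * supNorm K * (n : ℝ) ^ 2 / α / n) ^ 2 * (excessConst / (n : ℝ) ^ 4) := by
        gcongr
        exact hp.integral_excess_le hn2
    _ = _ := by field_simp; ring

lemma integrable_excess :
    Integrable (fun ω => max (18 * (estimator K H α t X ξ h ω - meanEstimator K H α t X ξ P h) ^ 2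
        - empV K H α t X ξ h ω) 0) P :=
  (((integrable_sq_estimator_sub hS hK hα hα1 hh h0 _).const_mul 18).sub
    (integrable_empV hS hK hα hα1 hh h0)).pos_part

omit hα hα1 h0 in
-- Each pair (observation, noise) has the same product law, so the index chosen to define `σ_h²` is
-- immaterial.
lemma secondMoment_congr (i j : Fin n) :
    secondMoment K H α t X ξ P j h = secondMoment K H α t X ξ P i h := by
  have := hS.indep.isProbabilityMeasure
  have hm : Measurable fun p : ℝ × ℝ =>
      (scaledKernel K h (p.1 - t) + 2 * supNorm K / ((α / (H.card : ℝ)) * h) * p.2) ^ 2 := by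
    have := hK.measurable
    unfold scaledKernel
    fun_prop
  have key : ∀ k : Fin n, secondMoment K H α t X ξ P k h = ∫ p : ℝ × ℝ,
      (scaledKernel K h (p.1 - t) + 2 * supNorm K / ((α / (H.card : ℝ)) * h) * p.2) ^ 2
        ∂((densityLaw f).prod laplaceLaw) := fun k => by
    have hi : IndepFun (X k) (ξ k h) P :=
      hS.indep.indepFun (i := Sum.inl k) (j := Sum.inr (k, ⟨h, hh⟩)) (by simp)
    have hmap := hi.map_prod_eq_prod_map_map (hS.measurable_obs k).aemeasurable
      (hS.measurable_noise k h hh).aemeasurable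
    rw [hS.law_obs, hS.law_noise k h hh] at hmap
    rw [← hmap, integral_map ((hS.measurable_obs k).prodMk
      (hS.measurable_noise k h hh)).aemeasurable hm.aestronglyMeasurable]
    rfl
  rw [key, key]

lemma integral_empV_le (i : Fin n) :
    ∫ ω, empV K H α t X ξ h ω ∂P ≤ 2 * V K H α t X ξ P i h := by
  have := hS.indep.isProbabilityMeasure
  have hn0 : (0 : ℝ) < n := by exact_mod_cast i.pos
  have hlog : 0 ≤ Real.log n := Real.log_natCast_nonneg n
  have hmom : ∫ ω, empSecondMoment K H α t X ξ h ω ∂P = secondMoment K H α t X ξ P i h := by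
    unfold empSecondMoment
    rw [integral_const_mul, integral_finsetSum _ fun j _ =>
      (memLp_release hS hK hα hα1 hh h0 j).integrable_sq]
    have : ∀ j, ∫ ω, release K H α t X ξ j h ω ^ 2 ∂P = secondMoment K H α t X ξ P i h :=
      fun j => secondMoment_congr hS hK hh i j
    simp_rw [this]
    simp
    field_simp
  have iM := (integrable_empSecondMoment (t := t) hS hK hα hα1 hh h0).div_const (n : ℝ)
  unfold empV V
  rw [integral_mul_const, integral_add (iM.const_mul _) (integrable_const _), integral_const_mul,
    integral_div, hmom]
  have : 0 ≤ 432 * (1 / ((n : ℝ) * h)) * Real.log n := by positivity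
  simp only [integral_const, probReal_univ, smul_eq_mul]
  linarith

lemma variance_estimator_le (i : Fin n) :
    Var[estimator K H α t X ξ h; P] ≤ secondMoment K H α t X ξ P i h / n := by
  have hp := hS.isPerturbedSample (t := t) hK hα hα1 hh h0
  have := hp.indep.isProbabilityMeasure
  have hn0 : (0 : ℝ) < n := by exact_mod_cast i.pos
  have hind : iIndepFun (fun i => release K H α t X ξ i h) P := by
    have := hp.iIndepFun_comp (g := fun _ x y => noiseScale K H α h * (x + y)) (fun i => by
      unfold Function.uncurry; fun_prop)
    simp_rw [← release_eq (t := t) (X := X) (ξ := ξ) hK hα hh h0] at this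
    exact this
  have hsum : estimator K H α t X ξ h =
      fun ω => (1 / (n : ℝ)) * (∑ i, release K H α t X ξ i h) ω := by
    ext ω; simp [estimator]
  rw [hsum, variance_const_mul, IndepFun.variance_sum
    (fun j _ => memLp_release hS hK hα hα1 hh h0 j) fun j _ k _ hjk => hind.indepFun hjk]
  calc _ ≤ (1 / (n : ℝ)) ^ 2 * ∑ _j : Fin n, secondMoment K H α t X ξ P i h := by
        gcongr with j
        rw [← secondMoment_congr hS hK hh i j]
        exact variance_le_expectation_sq
          (measurable_release hS hK hα hα1 hh h0 j).aestronglyMeasurable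
    _ = _ := by simp; field_simp

/-- Bias-variance bound for a single bandwidth. -/
lemma integral_sq_estimator_sub_le (i : Fin n) (c : ℝ) :
    ∫ ω, (estimator K H α t X ξ h ω - c) ^ 2 ∂P ≤
      |meanEstimator K H α t X ξ P h - c| ^ 2 + secondMoment K H α t X ξ P i h / n := by
  have := hS.indep.isProbabilityMeasure
  have hv := variance_estimator_le (t := t) hS hK hα hα1 hh h0 i
  have hL := memLp_estimator (t := t) hS hK hα hα1 hh h0
  have i1 := hL.integrable (by norm_num : (1 : ENNReal) ≤ 2)
  have e := variance_eq_sub (hL.sub (memLp_const c))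
  rw [show estimator K H α t X ξ h - (fun _ => c) = fun ω => estimator K H α t X ξ h ω - c from rfl,
    variance_sub_const hL.aestronglyMeasurable, integral_sub i1 (integrable_const _)] at e
  simp only [integral_const, probReal_univ, smul_eq_mul, one_mul, Pi.pow_apply] at e
  rw [sq_abs]
  change _ ≤ ((∫ ω, estimator K H α t X ξ h ω ∂P) - c) ^ 2 + _
  linarith

end Estimator

end Sample

lemma finite_below (H : Finset ℝ) (h : ℝ) : Finite {η : ℝ // η ∈ H ∧ η ≤ h} :=
  (H.finite_toSet.subset fun _ hη => hη.1 : {η : ℝ | η ∈ H ∧ η ≤ h}.Finite).to_subtype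

/-! ### Pathwise comparison of the selected bandwidth with a fixed one. -/

section Deterministic

variable {Ω : Type*} {K : ℝ → ℝ} {H : Finset ℝ}
  {α t : ℝ} {n : ℕ} {X : Fin n → Ω → ℝ} {ξ : Fin n → ℝ → Ω → ℝ} {h η : ℝ}

lemma le_empA (hη : η ∈ H) (hle : η ≤ h) (ω : Ω) :
    |estimator K H α t X ξ h ω - estimator K H α t X ξ η ω| ^ 2
      - (empV K H α t X ξ h ω + empV K H α t X ξ η ω) ≤ empA K H α t X ξ h ω := by
  have := finite_below H h
  refine (le_max_left _ 0).trans (le_ciSup (f := fun η : {η : ℝ // η ∈ H ∧ η ≤ h} =>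
    max (|estimator K H α t X ξ h ω - estimator K H α t X ξ η.1 ω| ^ 2
      - (empV K H α t X ξ h ω + empV K H α t X ξ η.1 ω)) 0)
    (Set.finite_range _).bddAbove ⟨η, hη, hle⟩)

lemma empA_nonneg (ω : Ω) : 0 ≤ empA K H α t X ξ h ω :=
  Real.iSup_nonneg fun _ => le_max_right _ _

/-- Any two estimators are close up to their comparison and variance terms. -/
lemma sq_estimator_sub_le (hh : h ∈ H) (hη : η ∈ H) (ω : Ω) :
    (estimator K H α t X ξ h ω - estimator K H α t X ξ η ω) ^ 2 ≤
      (empA K H α t X ξ h ω + empV K H α t X ξ h ω)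
        + (empA K H α t X ξ η ω + empV K H α t X ξ η ω) := by
  have n1 := empA_nonneg (K := K) (H := H) (α := α) (t := t) (X := X) (ξ := ξ) (h := h) ω
  have n2 := empA_nonneg (K := K) (H := H) (α := α) (t := t) (X := X) (ξ := ξ) (h := η) ω
  rcases le_total η h with hle | hle
  · have := le_empA (K := K) (α := α) (t := t) (X := X) (ξ := ξ) hη hle ω
    rw [sq_abs] at this
    linarith
  · have := le_empA (K := K) (α := α) (t := t) (X := X) (ξ := ξ) hh hle ω
    rw [sq_abs] at this
    linarith [sub_sq_comm (estimator K H α t X ξ h ω) (estimator K H α t X ξ η ω)]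

variable [MeasurableSpace Ω] {P : Measure Ω} {f : ℝ → ℝ}

lemma le_biasSq (hη : η ∈ H) (hle : η ≤ h) :
    |meanEstimator K H α t X ξ P η - f t| ^ 2 ≤ biasSq K H α t X ξ P f h := by
  have := finite_below H h
  exact le_ciSup (f := fun η : {η : ℝ // η ∈ H ∧ η ≤ h} =>
    |meanEstimator K H α t X ξ P η.1 - f t| ^ 2) (Set.finite_range _).bddAbove ⟨η, hη, hle⟩

/-- The comparison term is controlled by the bias and the excess stochastic errors. -/
lemma empA_le (hh : h ∈ H) (ω : Ω) :
    empA K H α t X ξ h ω ≤ 9 / 2 * biasSq K H α t X ξ P f h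
      + 2 * ∑ η ∈ H, max (18 * (estimator K H α t X ξ η ω - meanEstimator K H α t X ξ P η) ^ 2
        - empV K H α t X ξ η ω) 0 := by
  set R : ℝ → ℝ := fun η =>
    max (18 * (estimator K H α t X ξ η ω - meanEstimator K H α t X ξ P η) ^ 2
        - empV K H α t X ξ η ω) 0 with hR
  have hR0 : ∀ η, 0 ≤ R η := fun η => le_max_right _ _
  have hRle : ∀ η ∈ H, R η ≤ ∑ η ∈ H, R η := fun η hη =>
    Finset.single_le_sum (fun η _ => hR0 η) hη
  have hb := le_biasSq (K := K) (α := α) (t := t) (X := X) (ξ := ξ) (P := P) (f := f) hh le_rfl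
  have hb0 : 0 ≤ biasSq K H α t X ξ P f h := (by positivity : (0 : ℝ) ≤ _ ).trans hb
  have : Nonempty {η : ℝ // η ∈ H ∧ η ≤ h} := ⟨h, hh, le_rfl⟩
  refine ciSup_le ?_
  rintro ⟨η, hη, hle⟩
  have hbη := le_biasSq (K := K) (α := α) (t := t) (X := X) (ξ := ξ) (P := P) (f := f) hη hle
  have r1 : 18 * (estimator K H α t X ξ h ω - meanEstimator K H α t X ξ P h) ^ 2
        - empV K H α t X ξ h ω ≤ R h := le_max_left _ _
  have r2 : 18 * (estimator K H α t X ξ η ω - meanEstimator K H α t X ξ P η) ^ 2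
        - empV K H α t X ξ η ω ≤ R η := le_max_left _ _
  -- Each excess is bounded by the full sum separately, because `η = h` is allowed; hence the factor
  -- 2.
  have s1 := hRle h hh
  have s2 := hRle η hη
  refine max_le ?_ (by linarith [hR0 h])
  rw [sq_abs] at hb hbη ⊢
  simp only
  generalize estimator K H α t X ξ h ω = a at *
  generalize estimator K H α t X ξ η ω = b at *
  generalize meanEstimator K H α t X ξ P h = c at *
  generalize meanEstimator K H α t X ξ P η = d at *
  -- Weighted Young inequality favouring the bias: `(9/8) * 4 = 9/2` on the bias, and `9 * 2 = 18`
  -- on each stochastic error.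
  have k1 : (a - b) ^ 2 ≤ 9 / 8 * (c - d) ^ 2 + 9 * ((a - c) - (b - d)) ^ 2 := by
    nlinarith [sq_nonneg ((c - d) - 8 * ((a - c) - (b - d)))]
  have k2 : ((a - c) - (b - d)) ^ 2 ≤ 2 * (a - c) ^ 2 + 2 * (b - d) ^ 2 := by
    nlinarith [sq_nonneg ((a - c) + (b - d))]
  have k3 : (c - d) ^ 2 ≤ 2 * (c - f t) ^ 2 + 2 * (d - f t) ^ 2 := by
    nlinarith [sq_nonneg ((c - f t) + (d - f t))]
  linarith

/-- The deterministic oracle bound for a selected bandwidth. -/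
lemma IsSelector.sq_estimator_sub_le {hhat : Ω → ℝ} (hsel : IsSelector K H α t X ξ hhat)
    (hh : h ∈ H) (ω : Ω) :
    |estimator K H α t X ξ (hhat ω) ω - f t| ^ 2 ≤
      12 * biasSq K H α t X ξ P f h
        + 16 / 3 * ∑ η ∈ H,
          max (18 * (estimator K H α t X ξ η ω - meanEstimator K H α t X ξ P η) ^ 2
            - empV K H α t X ξ η ω) 0
        + 8 / 3 * empV K H α t X ξ h ω
        + 4 * (estimator K H α t X ξ h ω - f t) ^ 2 := by
  have h1 := PrivateKDE.sq_estimator_sub_le (K := K) (α := α) (t := t) (X := X) (ξ := ξ)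
    (hsel.mem ω) hh ω
  have h2 := hsel.minimises ω h hh
  have h3 := empA_le (K := K) (α := α) (t := t) (X := X) (ξ := ξ) (P := P) (f := f) hh ω
  rw [sq_abs]
  -- The weights 4/3 and 4 give bias coefficient `(8/3) * (9/2) = 12`, leaving 4 for the bias of the
  -- fixed estimator.
  have k : (estimator K H α t X ξ (hhat ω) ω - f t) ^ 2 ≤
      4 / 3 * (estimator K H α t X ξ (hhat ω) ω - estimator K H α t X ξ h ω) ^ 2
        + 4 * (estimator K H α t X ξ h ω - f t) ^ 2 := by
    nlinarith [sq_nonneg ((estimator K H α t X ξ (hhat ω) ω - estimator K H α t X ξ h ω)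
      - 3 * (estimator K H α t X ξ h ω - f t))]
  linarith

end Deterministic

/-! ### Taking expectations and assembling the oracle inequality. -/

variable {Ω : Type*} [MeasurableSpace Ω] {P : Measure Ω} {K f : ℝ → ℝ} {H : Finset ℝ}
  {α t : ℝ} {n : ℕ} {X : Fin n → Ω → ℝ} {ξ : Fin n → ℝ → Ω → ℝ} {h : ℝ} {hhat : Ω → ℝ}

lemma integrable_sq_selected (hS : IsSample P f H X ξ) (hK : IsKernel K) (hα : 0 < α)
    (hα1 : α < 1) (hH : ∀ h ∈ H, 0 < h) (hsel : IsSelector K H α t X ξ hhat) :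
    Integrable (fun ω => |estimator K H α t X ξ (hhat ω) ω - f t| ^ 2) P := by
  -- Splitting over the finitely many values of `hhat` handles measurability and integrability at
  -- once.
  have e : (fun ω => |estimator K H α t X ξ (hhat ω) ω - f t| ^ 2) = fun ω =>
      ∑ h ∈ H, (hhat ⁻¹' {h}).indicator (fun ω => (estimator K H α t X ξ h ω - f t) ^ 2) ω := by
    ext ω
    rw [Finset.sum_eq_single_of_mem (hhat ω) (hsel.mem ω) fun h _ hne =>
      Set.indicator_of_notMem (fun hmem => hne hmem.symm) _,
      Set.indicator_of_mem (show ω ∈ hhat ⁻¹' {hhat ω} from rfl), sq_abs]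
  rw [e]
  exact integrable_finsetSum _ fun h hh =>
    (integrable_sq_estimator_sub hS hK hα hα1 hh (hH h hh) _).indicator
      (hsel.measurable (measurableSet_singleton h))

lemma integral_sq_selected_le (hS : IsSample P f H X ξ) (hK : IsKernel K) (hα : 0 < α)
    (hα1 : α < 1) (hH : ∀ h ∈ H, 0 < h) (hnH : ∀ h ∈ H, 1 ≤ n * h) (hcard : H.card ≤ n)
    (hn2 : 2 ≤ n) (hsel : IsSelector K H α t X ξ hhat) (hh : h ∈ H) (i : Fin n) :
    ∫ ω, |estimator K H α t X ξ (hhat ω) ω - f t| ^ 2 ∂P ≤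
      16 * (biasSq K H α t X ξ P f h + V K H α t X ξ P i h)
        + 64 / 3 * supNorm K ^ 2 * excessConst / (n * α ^ 2) := by
  have := hS.indep.isProbabilityMeasure
  have h0 := hH h hh
  have hn2' : (2 : ℝ) ≤ n := by exact_mod_cast hn2
  have hn0 : (0 : ℝ) < n := by linarith
  have iR : Integrable (fun ω => ∑ η ∈ H,
      max (18 * (estimator K H α t X ξ η ω - meanEstimator K H α t X ξ P η) ^ 2
        - empV K H α t X ξ η ω) 0) P :=
    integrable_finsetSum _ fun η hη => integrable_excess hS hK hα hα1 hη (hH η hη)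
  have iV := integrable_empV (t := t) hS hK hα hα1 hh h0
  have iE := integrable_sq_estimator_sub (t := t) hS hK hα hα1 hh h0 (f t)
  have i1 : Integrable (fun ω => 12 * biasSq K H α t X ξ P f h
      + 16 / 3 * ∑ η ∈ H,
          max (18 * (estimator K H α t X ξ η ω - meanEstimator K H α t X ξ P η) ^ 2
            - empV K H α t X ξ η ω) 0) P := (integrable_const _).add (iR.const_mul _)
  have i2 : Integrable (fun ω => 12 * biasSq K H α t X ξ P f h
      + 16 / 3 * ∑ η ∈ H,
          max (18 * (estimator K H α t X ξ η ω - meanEstimator K H α t X ξ P η) ^ 2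
            - empV K H α t X ξ η ω) 0 + 8 / 3 * empV K H α t X ξ h ω) P := i1.add (iV.const_mul _)
  have hmono := integral_mono (integrable_sq_selected hS hK hα hα1 hH hsel)
    (i2.add (iE.const_mul 4)) (hsel.sq_estimator_sub_le (P := P) (f := f) hh)
  rw [integral_add' i2 (iE.const_mul 4), integral_add i1 (iV.const_mul _),
    integral_add (integrable_const _) (iR.const_mul _), integral_const, integral_const_mul,
    integral_const_mul, integral_const_mul, integral_finsetSum _ fun η hη =>
      integrable_excess hS hK hα hα1 hη (hH η hη)] at hmono
  simp only [probReal_univ, smul_eq_mul, one_mul] at hmono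
  have bR : ∑ η ∈ H, ∫ ω,
      max (18 * (estimator K H α t X ξ η ω - meanEstimator K H α t X ξ P η) ^ 2
        - empV K H α t X ξ η ω) 0 ∂P ≤ 4 * supNorm K ^ 2 * excessConst / (n * α ^ 2) := by
    have hC : 0 ≤ excessConst := by unfold excessConst; positivity
    have hc : (H.card : ℝ) ≤ n := by exact_mod_cast hcard
    calc _ ≤ ∑ _η ∈ H, 4 * supNorm K ^ 2 * excessConst / ((n : ℝ) ^ 2 * α ^ 2) :=
          Finset.sum_le_sum fun η hη =>
            integral_excess_le hS hK hα hα1 hη (hH η hη) hn2 hcard (hnH η hη)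
      _ = H.card * (4 * supNorm K ^ 2 * excessConst / ((n : ℝ) ^ 2 * α ^ 2)) := by
          rw [Finset.sum_const, nsmul_eq_mul]
      _ ≤ n * (4 * supNorm K ^ 2 * excessConst / ((n : ℝ) ^ 2 * α ^ 2)) := by gcongr
      _ = _ := by field_simp
  have bV := integral_empV_le (t := t) hS hK hα hα1 hh h0 i
  have bE := integral_sq_estimator_sub_le (t := t) hS hK hα hα1 hh h0 i (f t)
  have bB := le_biasSq (K := K) (α := α) (t := t) (X := X) (ξ := ξ) (P := P) (f := f) hh le_rfl
  have hlog : 1 / 2 ≤ Real.log n := by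
    have := Real.log_le_log (by norm_num) hn2'
    linarith [Real.log_two_gt_d9]
  have hσ : 0 ≤ secondMoment K H α t X ξ P i h / n :=
    div_nonneg (integral_nonneg fun ω => sq_nonneg _) hn0.le
  -- The variance at `h` is negligible against `V`: the total coefficient of `V` is `16/3 + 4/300 ≤
  -- 16`, and that of the bias is `12 + 4 = 16`.
  have bσ : 300 * (secondMoment K H α t X ξ P i h / n) ≤ V K H α t X ξ P i h := by
    have h1 : 0 ≤ 432 * (1 / ((n : ℝ) * h)) * Real.log n := by positivity
    have h2 : secondMoment K H α t X ξ P i h / n * (1 / 2)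
      ≤ secondMoment K H α t X ξ P i h / n * Real.log n := by gcongr
    rw [V, add_mul]
    linarith
  have eC : 64 / 3 * supNorm K ^ 2 * excessConst / (n * α ^ 2)
      = 16 / 3 * (4 * supNorm K ^ 2 * excessConst / (n * α ^ 2)) := by ring
  rw [eC]
  linarith

end PrivateKDE
end

theorem mainTheorem2 :
    ∃ C : ℝ → ℝ,
      ∀ {Ω : Type*} [MeasurableSpace Ω] (P : Measure Ω) [IsProbabilityMeasure P]
        (K : ℝ → ℝ) (_ : PrivateKDE.IsKernel K)
        (f : ℝ → ℝ) (_ : PrivateKDE.IsDensity f)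
        (t : ℝ) (α : ℝ) (_ : 0 < α) (_ : α < 1)
        (n : ℕ) (H : Finset ℝ) (hne : H.Nonempty)
        (_ : ∀ h ∈ H, 0 < h ∧ h < 1) (_ : H.card ≤ n)
        (_ : ∀ h ∈ H, max (Real.log (n : ℝ)) 1 ≤ (n : ℝ) * h)
        (X : Fin n → Ω → ℝ) (ξ : Fin n → ℝ → Ω → ℝ)
        (_ : PrivateKDE.IsSample P f H X ξ)
        (hhat : Ω → ℝ) (_ : PrivateKDE.IsSelector K H α t X ξ hhat)
        (i : Fin n),
        Integrable
          (fun ω => |PrivateKDE.estimator K H α t X ξ (hhat ω) ω - f t| ^ 2) P ∧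
        ∫ ω, |PrivateKDE.estimator K H α t X ξ (hhat ω) ω - f t| ^ 2 ∂P
          ≤ 16 * H.inf' hne (fun h =>
                PrivateKDE.biasSq K H α t X ξ P f h + PrivateKDE.V K H α t X ξ P i h)
            + C (PrivateKDE.supNorm K) / ((n : ℝ) * α ^ 2) := by
  refine ⟨fun M => 64 / 3 * M ^ 2 * PrivateKDE.excessConst, ?_⟩
  intro Ω _ P _ K hK f _ t α hα hα1 n H hne hH hcard hnH X ξ hS hhat hsel i
  have hpos : ∀ h ∈ H, 0 < h := fun h hh => (hH h hh).1
  have hone : ∀ h ∈ H, 1 ≤ (n : ℝ) * h := fun h hh => (le_max_right _ _).trans (hnH h hh)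
  -- `h < 1` and `nh ≥ 1` exclude `n = 1`, where `log n` vanishes.
  have hn2 : 2 ≤ n := by
    obtain ⟨h, hh⟩ := hne
    have h1 := hone h hh
    have h2 := hH h hh
    have hi := i.pos
    by_contra hlt
    obtain rfl : n = 1 := by omega
    norm_num at h1
    linarith
  refine ⟨PrivateKDE.integrable_sq_selected hS hK hα hα1 hpos hsel, ?_⟩
  obtain ⟨h, hh, heq⟩ := H.exists_mem_eq_inf' hne (fun h =>
    PrivateKDE.biasSq K H α t X ξ P f h + PrivateKDE.V K H α t X ξ P i h)
  rw [heq]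
  exact PrivateKDE.integral_sq_selected_le hS hK hα hα1 hpos hone hcard hn2 hsel hh i
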